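/- **Conventions.** Distinct points of $\mathbb{Z}^2$ are $c_1$-adjacent if they agree in one coordinate and differ by $1$ in the other, and $c_2$-adjacent if both coordinates differ by at most $1$. A $\kappa$-path is a finite sequence of points in which consecutive points are equal or $\kappa$-adjacent; a set is $\kappa$-connected if any two of its points are joined by a $\kappa$-path in it. For $X\subset\mathbb{Z}^2$, a map $f:X\to X$ is $c_1$-continuous if it maps $c_1$-connected sets to $c_1$-connected sets. A point $x\in X$ is a $c_1$-approximate fixed point of $f$ if $f(x)$ is equal or $c_1$-adjacent to $x$. A set $A\subset X$ is a freezing set for $(X,c_1)$ if $\mathrm{id}_X$ is the only $c_1$-continuous $g:X\to X$ that fixes every point of $A$. A digital line segment is a nonempty finite $c_2$-connected set of collinear points of $\mathbb{Z}^2$. One with at least two points is axis-parallel (horizontal or vertical) or slanted (slope $\pm1$). Its endpoints are its points with at most one $c_2$-neighbor in it. A closed curve $C$ is a $c_2$-path $s_0,\dots,s_m=s_0$, $m\ge 1$, with $s_i\ne s_j$ for $0<|i-j|<m$. Its maximal segments are the maximal digital line segments formed by (cyclically) consecutive points of $C$. $C$ is a bounding curve of $D\subset\mathbb{Z}^2$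 if $\mathbb{Z}^2\setminus C$ has exactly two $c_1$-components, a finite one $\mathrm{Int}(C)$ and an infinite one, and $D=C\cup\mathrm{Int}(C)$; a set $D$ that has a bounding curve is a digital disk. Two maximal segments of a bounding curve $C$ that meet in exactly one point $p$ form an interior angle at $p$, namely the sector between them on the side of $\mathrm{Int}(C)$. A disk $V$ is thick if it has a bounding curve $C$ such that: * for every maximal slanted segment of $C$ and every point $p$ of it that is not an endpoint of it, some $c\in V$ is $c_2$-adjacent but not $c_1$-adjacent to $p$; * for every interior angle of $90^\circ$ of $C$, with vertex $p$, there is $q\in\mathrm{Int}(C)$ that is $c_2$-adjacent but not $c_1$-adjacent to $p$ if the sides are axis-parallel, and $c_1$-adjacent to $p$ if the sides are slanted; * for every interior angle of $135^\circ$ of $C$, with vertex $p$, there are $b,b'\in V$ in the interior of the angle such that $b$ is $c_2$-adjacent but not $c_1$-adjacent to $p$, and $b'$ is $c_1$-adjacent to $p$. A disk $V$ is convex if it has a bounding curve such that the endpoints of its maximal segments are exactly the vertices of the convex hull of $V$ in $\mathbb{R}^2$. **Theorem 6.4.** Let $V_1,\dots,V_n\subset X\subset\mathbb{Z}^2$,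 where each $V_i$ is a thick convex disk, and let $X'=\bigcup_{i=1}^n V_i$. For each $i$ let $C_i$ be any bounding curve of $V_i$, let $A_{1,i}$ be the set of endpoints of the maximal axis-parallel segments of $C_i$, and let $A_{2,i}$ be the union of the maximal slanted segments of $C_i$. Put $$A=(X\setminus X')\cup\bigcup_{i=1}^n (A_{1,i}\cup A_{2,i}).$$ 1. $A$ is a freezing set for $(X,c_1)$. 2. If $f:X\to X$ is $c_1$-continuous and every point of $A$ is a $c_1$-approximate fixed point of $f$, then every point of $X$ is a $c_1$-approximate fixed point of $f$. -/

import Mathlib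

open scoped Topology

namespace Digital

/-- The `c₁`-adjacency (4-adjacency) on `ℤ²`: distinct points that agree in one coordinate and
differ by exactly `1` in the other. -/
def c1 : SimpleGraph (ℤ × ℤ) where
  Adj p q := (|p.1 - q.1| = 1 ∧ p.2 = q.2) ∨ (p.1 = q.1 ∧ |p.2 - q.2| = 1)
  symm := ⟨by
    rintro p q (⟨h, h'⟩ | ⟨h, h'⟩)
    · exact Or.inl ⟨by rw [abs_sub_comm]; exact h, h'.symm⟩
    · exact Or.inr ⟨h.symm, by rw [abs_sub_comm]; exact h'⟩⟩
  loopless := ⟨by rintro p (⟨h, -⟩ | ⟨-, h⟩) <;> simp at h⟩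

/-- The `c₂`-adjacency (8-adjacency) on `ℤ²`: distinct points whose coordinates differ by at
most `1`. -/
def c2 : SimpleGraph (ℤ × ℤ) where
  Adj p q := p ≠ q ∧ |p.1 - q.1| ≤ 1 ∧ |p.2 - q.2| ≤ 1
  symm := ⟨by
    rintro p q ⟨h, h1, h2⟩
    exact ⟨h.symm, by rw [abs_sub_comm]; exact h1, by rw [abs_sub_comm]; exact h2⟩⟩
  loopless := ⟨by rintro p ⟨h, -⟩; exact h rfl⟩

/-- A set of vertices is connected if any two of its points are joined by a path inside it. -/
def IsConn {V : Type*} (κ : SimpleGraph V) (Y : Set V) : Prop :=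
  (κ.induce Y).Preconnected

/-- Digital continuity: the image of every connected set is connected. -/
def IsContinuous {V W : Type*} (κ : SimpleGraph V) (l : SimpleGraph W) (f : V → W) : Prop :=
  ∀ Y : Set V, IsConn κ Y → IsConn l (f '' Y)

/-- `f ∈ C(X, κ)`: a continuous self-map of the digital image `(X, κ)`. -/
def IsContinuousSelfMap {V : Type*} (κ : SimpleGraph V) (X : Set V) (f : X → X) : Prop :=
  IsContinuous (κ.induce X) (κ.induce X) f

/-- `x` is an approximate fixed point of `f`: `f x` is equal or adjacent to `x`. -/
def IsApproxFixedPt {V : Type*} (κ : SimpleGraph V) {X : Set V} (f : X → X) (x : X) : Prop :=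
  x = f x ∨ (κ.induce X).Adj x (f x)

/-- `A ⊆ X` is a freezing set for `(X, κ)`: the identity is the only continuous self-map of `X`
that fixes every point of `A`. -/
def IsFreezingSet {V : Type*} (κ : SimpleGraph V) (X A : Set V) : Prop :=
  A ⊆ X ∧ ∀ g : X → X, IsContinuousSelfMap κ X g →
    (∀ x : X, (x : V) ∈ A → Function.IsFixedPt g x) → g = id

/-- The inclusion of `ℤ²` in the real plane. -/
def toPlane (p : ℤ × ℤ) : ℝ × ℝ := ((p.1 : ℝ), (p.2 : ℝ))

/-! ### Digital line segments -/

/-- A digital line segment: a finite `c₂`-connected collinear set of lattice points. -/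
def IsLineSegment (σ : Set (ℤ × ℤ)) : Prop :=
  σ.Nonempty ∧ σ.Finite ∧ IsConn c2 σ ∧ Collinear ℝ (toPlane '' σ)

/-- An axis-parallel (horizontal or vertical) set with at least two points. -/
def IsAxisParallel (σ : Set (ℤ × ℤ)) : Prop :=
  σ.Nontrivial ∧ ((∀ p ∈ σ, ∀ q ∈ σ, p.2 = q.2) ∨ (∀ p ∈ σ, ∀ q ∈ σ, p.1 = q.1))

/-- A slanted set (slope `1` or slope `-1`) with at least two points. -/
def IsSlanted (σ : Set (ℤ × ℤ)) : Prop :=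
  σ.Nontrivial ∧ ((∀ p ∈ σ, ∀ q ∈ σ, q.2 - p.2 = q.1 - p.1) ∨
    (∀ p ∈ σ, ∀ q ∈ σ, q.2 - p.2 = -(q.1 - p.1)))

/-- The endpoints of a digital line segment: its points with at most one `c₂`-neighbour in it. -/
def IsEndpoint (σ : Set (ℤ × ℤ)) (p : ℤ × ℤ) : Prop :=
  p ∈ σ ∧ {q ∈ σ | c2.Adj p q}.Subsingleton

/-! ### Closed curves and disks -/

/-- A `c₂`-closed curve `s₀, s₁, …, s_m = s₀`: consecutive points are equal or `c₂`-adjacent, and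
`s_i ≠ s_j` for `0 < |i - j| < m`.  The sequence is extended `m`-periodically, so that
`s a, s (a+1), …, s b` runs over the arcs of the curve, wherever they start. -/
structure ClosedCurve where
  s : ℕ → ℤ × ℤ
  m : ℕ
  m_pos : 0 < m
  periodic : ∀ i, s (i + m) = s i
  step : ∀ i, s i = s (i + 1) ∨ c2.Adj (s i) (s (i + 1))
  inj : ∀ i j, i < m → j < m → s i = s j → i = j

/-- The finite `c₁`-components of `ℤ² ∖ S`, taken together.  For a bounding curve there is exactly
one such component. -/
def inside (S : Set (ℤ × ℤ)) : Set (ℤ × ℤ) :=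
  {p | ∃ h : p ∈ Sᶜ, ((c1.induce Sᶜ).connectedComponentMk ⟨p, h⟩).supp.Finite}

namespace ClosedCurve

/-- The set of points of a closed curve. -/
def pts (C : ClosedCurve) : Set (ℤ × ℤ) := Set.range C.s

/-- `C` is a bounding curve of `D`: the complement of `C` has exactly two `c₁`-components, one
finite and one infinite, and `D` is the union of `C` and the finite one. -/
def IsBoundingCurve (C : ClosedCurve) (D : Set (ℤ × ℤ)) : Prop :=
  (∃ I E : (c1.induce C.ptsᶜ).ConnectedComponent,
    (∀ K, K = I ∨ K = E) ∧ I.supp.Finite ∧ E.supp.Infinite) ∧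
  D = C.pts ∪ inside C.pts

/-- A segment of a closed curve: a digital line segment formed by consecutive points of it. -/
def IsSegment (C : ClosedCurve) (σ : Set (ℤ × ℤ)) : Prop :=
  IsLineSegment σ ∧ ∃ a b : ℕ, σ = C.s '' Set.Icc a b

/-- A maximal segment (side) of a closed curve. -/
def IsSide (C : ClosedCurve) (σ : Set (ℤ × ℤ)) : Prop :=
  Maximal C.IsSegment σ

/-- The set of endpoints of the maximal axis-parallel segments of `C`. -/
def axisParallelEndpoints (C : ClosedCurve) : Set (ℤ × ℤ) :=
  {p | ∃ σ, C.IsSide σ ∧ IsAxisParallel σ ∧ IsEndpoint σ p}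

/-- The union of the maximal slanted segments of `C`. -/
def slantedPoints (C : ClosedCurve) : Set (ℤ × ℤ) :=
  {p | ∃ σ, C.IsSide σ ∧ IsSlanted σ ∧ p ∈ σ}

/-- The closed polygonal curve in the real plane that joins consecutive points of `C`. -/
def trace (C : ClosedCurve) : Set (ℝ × ℝ) :=
  ⋃ i : ℕ, segment ℝ (toPlane (C.s i)) (toPlane (C.s (i + 1)))

end ClosedCurve

/-- A digital disk. -/
def IsDisk (D : Set (ℤ × ℤ)) : Prop :=
  ∃ C : ClosedCurve, C.IsBoundingCurve D

/-! ### Interior angles and thickness -/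

/-- The eight steps to the `c₂`-neighbours of a point, counterclockwise from east, each `45°` from
the preceding one. -/
def dir (d : ZMod 8) : ℤ × ℤ :=
  (![(1, 0), (1, 1), (0, 1), (-1, 1), (-1, 0), (-1, -1), (0, -1), (1, -1)] : Fin 8 → ℤ × ℤ) d

/-- `C` has at `p` an interior angle of measure `k · 45°` with sides `σ` and `τ`: these are maximal
segments of `C` that meet exactly in `p`, they leave `p` in the directions `d` and `d + k`, and the
sector swept counterclockwise from `d` to `d + k` is the one on the side of the interior of `C`,
that is, its points close to `p` can be joined to interior points without meeting the curve.
(The vector `dir d + dir (d + 1)` points strictly into that sector, next to its first ray; close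
to `p`, the curve consists of the two rays only.) -/
structure IsInteriorAngle (C : ClosedCurve) (p : ℤ × ℤ) (σ τ : Set (ℤ × ℤ)) (d : ZMod 8) (k : ℕ) :
    Prop where
  side_left : C.IsSide σ
  side_right : C.IsSide τ
  inter : σ ∩ τ = {p}
  k_pos : 0 < k
  k_lt : k < 8
  dir_left : p + dir d ∈ σ
  dir_right : p + dir (d + (k : ZMod 8)) ∈ τ
  interior_side : ∀ᶠ t : ℝ in 𝓝[>] 0, ∃ z ∈ inside C.pts,
    JoinedIn C.traceᶜ (toPlane p + t • toPlane (dir d + dir (d + 1))) (toPlane z)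

/-- `X` is slant-thick at `p`. -/
def IsSlantThickAt (X : Set (ℤ × ℤ)) (p : ℤ × ℤ) : Prop :=
  ∃ c ∈ X, c2.Adj c p ∧ ¬ c1.Adj p c

/-- A disk with bounding curve `C` is `90°`-thick at the vertex `p` of an angle with sides
`σ` and `τ`. -/
def Is90ThickAt (C : ClosedCurve) (p : ℤ × ℤ) (σ τ : Set (ℤ × ℤ)) : Prop :=
  ∃ q ∈ inside C.pts,
    (IsAxisParallel σ ∧ IsAxisParallel τ → c2.Adj q p ∧ ¬ c1.Adj p q) ∧
    (IsSlanted σ ∧ IsSlanted τ → c1.Adj q p)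

/-- `X` is `135°`-thick at the vertex `p` of the angle swept counterclockwise from direction `d` to
direction `d + 3`; the neighbours of `p` in the interior of the angle are `p + dir (d + j)` with
`0 < j < 3`. -/
def Is135ThickAt (X : Set (ℤ × ℤ)) (p : ℤ × ℤ) (d : ZMod 8) : Prop :=
  ∃ b ∈ X, ∃ b' ∈ X,
    (∃ j : ℕ, 0 < j ∧ j < 3 ∧ b = p + dir (d + (j : ZMod 8))) ∧
    (∃ j : ℕ, 0 < j ∧ j < 3 ∧ b' = p + dir (d + (j : ZMod 8))) ∧
    (c2.Adj b p ∧ ¬ c1.Adj p b) ∧ c1.Adj b' p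

/-- A thick digital disk. -/
def IsThickDisk (X : Set (ℤ × ℤ)) : Prop :=
  ∃ C : ClosedCurve, C.IsBoundingCurve X ∧
    (∀ σ p, C.IsSide σ → IsSlanted σ → p ∈ σ → ¬ IsEndpoint σ p → IsSlantThickAt X p) ∧
    (∀ p σ τ d, IsInteriorAngle C p σ τ d 2 → Is90ThickAt C p σ τ) ∧
    (∀ p σ τ d, IsInteriorAngle C p σ τ d 3 → Is135ThickAt X p d)

/-! ### Convexity -/

/-- The vertices of the convex hull of `Y` in the real plane. -/
def hullVertices (Y : Set (ℤ × ℤ)) : Set (ℝ × ℝ) :=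
  Set.extremePoints ℝ (convexHull ℝ (toPlane '' Y))

/-- Digital convexity: a single point, a digital line segment, or a digital disk with a bounding
curve such that the endpoints of its maximal segments are the vertices of the convex hull. -/
def IsDigitallyConvex (Y : Set (ℤ × ℤ)) : Prop :=
  (∃ p, Y = {p}) ∨ IsLineSegment Y ∨
    ∃ C : ClosedCurve, C.IsBoundingCurve Y ∧
      toPlane '' {p | ∃ σ, C.IsSide σ ∧ IsEndpoint σ p} = hullVertices Y

/-- A thick convex disk.  The curves that witness thickness and convexity may differ. -/
def IsThickConvexDisk (Y : Set (ℤ × ℤ)) : Prop :=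
  IsDisk Y ∧ IsThickDisk Y ∧ IsDigitallyConvex Y

end Digital

namespace Digital

/-! Both claims are one statement about the displacement `dist1 (f x) x`: a bound `k` on `A` spreads
to all of `X`. Taking `k = 0` gives freezing, `k = 1` gives approximate fixed points. A continuous
map is `1`-Lipschitz along axis-parallel runs in `X`. If `f` pushed an interior point of a run by
more than `k`, then one end of the run, the one away from which the push goes, would be displaced by
more than `k` too (`dist1_le_of_run`). This is used twice. Each curve point lies on a slanted side,
contained in `A`, or on an axis-parallel side whose endpoints lie in `A` (`dist1_le_of_mem_pts`).
Each inside point lies on a horizontal run with both ends on the curve (`dist1_le_of_mem_inside`).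
-/

/-- The `ℓ¹`-distance on `ℤ²`. -/
def dist1 (p q : ℤ × ℤ) : ℤ := |p.1 - q.1| + |p.2 - q.2|

lemma dist1_le_zero_iff {p q : ℤ × ℤ} : dist1 p q ≤ 0 ↔ p = q := by
  rw [Prod.ext_iff]
  simp only [dist1]
  grind

lemma dist1_le_one_iff {p q : ℤ × ℤ} : dist1 p q ≤ 1 ↔ p = q ∨ c1.Adj p q := by
  rw [Prod.ext_iff]
  simp only [dist1, c1]
  grind

lemma dist1_triangle (p q r : ℤ × ℤ) : dist1 p r ≤ dist1 p q + dist1 q r := by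
  have h1 := abs_sub_le p.1 q.1 r.1
  have h2 := abs_sub_le p.2 q.2 r.2
  simp only [dist1]
  linarith

lemma dist1_comm (p q : ℤ × ℤ) : dist1 p q = dist1 q p := by
  simp only [dist1, abs_sub_comm]

lemma fst_add_nsmul (x e : ℤ × ℤ) (n : ℕ) : (x + n • e).1 = x.1 + n * e.1 := by
  rw [Prod.fst_add, Prod.smul_fst, nsmul_eq_mul]

lemma snd_add_nsmul (x e : ℤ × ℤ) (n : ℕ) : (x + n • e).2 = x.2 + n * e.2 := by
  rw [Prod.snd_add, Prod.smul_snd, nsmul_eq_mul]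

lemma adj_add_nsmul {e : ℤ × ℤ} (he : dist1 e 0 = 1) (x : ℤ × ℤ) (n : ℕ) :
    c1.Adj (x + (n + 1) • e) (x + n • e) := by
  have h2 : x + (n + 1) • e ≠ x + n • e := by
    intro h3
    rw [add_smul, ← add_assoc, one_smul, add_eq_left] at h3
    simp [h3, dist1] at he
  refine (dist1_le_one_iff.1 ?_).resolve_left h2
  rw [add_smul, ← add_assoc, one_smul, ← he]
  simp [dist1]

/-! ### Continuous maps and displacement along runs -/

lemma isConn_pair {W : Type*} {κ : SimpleGraph W} {x y : W} (h : κ.Adj x y) :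
    IsConn κ {x, y} := by
  have hxy : (κ.induce {x, y}).Adj ⟨x, by simp⟩ ⟨y, by simp⟩ := h
  rintro ⟨u, rfl | rfl⟩ ⟨v, rfl | rfl⟩
  · exact SimpleGraph.Reachable.refl _
  · exact hxy.reachable
  · exact hxy.symm.reachable
  · exact SimpleGraph.Reachable.refl _

lemma eq_or_adj_of_isConn_pair {W : Type*} {κ : SimpleGraph W} {x y : W}
    (h : IsConn κ {x, y}) : x = y ∨ κ.Adj x y := by
  obtain ⟨w⟩ := h ⟨x, by simp⟩ ⟨y, by simp⟩
  cases w with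
  | nil => exact Or.inl rfl
  | @cons _ v _ hadj _ =>
    obtain ⟨v, rfl | rfl⟩ := v
    · exact (κ.loopless.irrefl _ hadj).elim
    · exact Or.inr hadj

/-- A continuous map sends adjacent points to equal or adjacent points. -/
lemma IsContinuous.eq_or_adj {U W : Type*} {κ : SimpleGraph U} {l : SimpleGraph W} {f : U → W}
    (hf : IsContinuous κ l f) {x y : U} (h : κ.Adj x y) : f x = f y ∨ l.Adj (f x) (f y) := by
  have := hf _ (isConn_pair h)
  rw [Set.image_pair] at this
  exact eq_or_adj_of_isConn_pair this

lemma isApproxFixedPt_iff {X : Set (ℤ × ℤ)} {f : X → X} {x : X} :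
    IsApproxFixedPt c1 f x ↔ dist1 (f x) x ≤ 1 := by
  rw [dist1_comm, dist1_le_one_iff, IsApproxFixedPt, Subtype.ext_iff]
  rfl

/-- A continuous self-map is `1`-Lipschitz for the `ℓ¹`-distance along straight runs. -/
lemma dist1_map_le {X : Set (ℤ × ℤ)} {f : X → X} (hf : IsContinuousSelfMap c1 X f)
    {e : ℤ × ℤ} (he : dist1 e 0 = 1) (x : ℤ × ℤ) (n : ℕ) (h : ∀ k ≤ n, x + k • e ∈ X) :
    dist1 (f ⟨x + n • e, h n le_rfl⟩) (f ⟨x + 0 • e, h 0 n.zero_le⟩) ≤ n := by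
  induction n with
  | zero => simp [dist1]
  | succ n ih =>
    have h1 := ih fun k hk => h k (by omega)
    have hadj : (c1.induce X).Adj ⟨x + (n + 1) • e, h _ le_rfl⟩ ⟨x + n • e, h n (by omega)⟩ :=
      adj_add_nsmul he x n
    have h2 : dist1 (f ⟨x + (n + 1) • e, h _ le_rfl⟩) (f ⟨x + n • e, h n (by omega)⟩) ≤ 1 :=
      dist1_le_one_iff.2 ((IsContinuous.eq_or_adj hf hadj).imp (congrArg Subtype.val) id)
    refine (dist1_triangle _ (f ⟨x + n • e, h n (by omega)⟩) _).trans ?_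
    push_cast
    linarith

/-- If the points at both ends of an axis-parallel run are displaced by at most `k`, so are the
points between them. -/
lemma dist1_le_of_run {X : Set (ℤ × ℤ)} {f : X → X} (hf : IsContinuousSelfMap c1 X f)
    {e : ℤ × ℤ} (he : e = (1, 0) ∨ e = (0, 1)) {x : ℤ × ℤ} (hx : x ∈ X) {a b : ℕ}
    (ha : ∀ j ≤ a, x + j • (-e) ∈ X) (hb : ∀ j ≤ b, x + j • e ∈ X) {k : ℤ}
    (hka : dist1 (f ⟨_, ha a le_rfl⟩) (x + a • (-e)) ≤ k)
    (hkb : dist1 (f ⟨_, hb b le_rfl⟩) (x + b • e) ≤ k) : dist1 (f ⟨x, hx⟩) x ≤ k := by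
  have h1 := dist1_map_le hf (by rcases he with rfl | rfl <;> simp [dist1]) x a ha
  have h2 := dist1_map_le hf (by rcases he with rfl | rfl <;> simp [dist1]) x b hb
  have ea := dist1_triangle (f ⟨x, hx⟩) (f ⟨_, ha a le_rfl⟩) (x + a • (-e))
  have eb := dist1_triangle (f ⟨x, hx⟩) (f ⟨_, hb b le_rfl⟩) (x + b • e)
  simp only [zero_smul, add_zero] at h1 h2
  rw [dist1_comm] at h1 h2
  have ga := ea.trans (add_le_add h1 hka)
  have gb := eb.trans (add_le_add h2 hkb)
  clear ea eb h1 h2 hka hkb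
  generalize (f ⟨x, hx⟩ : ℤ × ℤ) = z at *
  simp only [dist1, fst_add_nsmul, snd_add_nsmul, Prod.fst_neg, Prod.snd_neg] at ga gb ⊢
  clear ha hb
  -- With the run lengths cancelled, `ga` bounds the signed shift along `e` plus the transverse
  -- shift by `k`; `gb` does so with the opposite sign.
  rcases he with rfl | rfl
  · simp only [mul_zero, mul_one, neg_zero, add_zero, mul_neg] at ga gb
    have h1 := le_abs_self (z.1 - (x.1 + -(a : ℤ)))
    have h2 := neg_le_abs (z.1 - (x.1 + (b : ℤ)))
    rcases abs_cases (z.1 - x.1) with h | h <;> linarith [h.1]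
  · simp only [mul_zero, mul_one, neg_zero, add_zero, mul_neg] at ga gb
    have h1 := le_abs_self (z.2 - (x.2 + -(a : ℤ)))
    have h2 := neg_le_abs (z.2 - (x.2 + (b : ℤ)))
    rcases abs_cases (z.2 - x.2) with h | h <;> linarith [h.1]

/-! ### Axis-parallel rays -/

/-- A finite set is left after finitely many steps in a fixed direction. -/
lemma exists_last {S : Set (ℤ × ℤ)} (hS : S.Finite) {x e : ℤ × ℤ} (hx : x ∈ S) (he : e ≠ 0) :
    ∃ n : ℕ, (∀ j ≤ n, x + j • e ∈ S) ∧ x + (n + 1) • e ∉ S := by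
  classical
  have hex : ∃ n : ℕ, x + n • e ∉ S := by
    by_contra! h
    refine Set.infinite_of_injective_forall_mem (f := fun n : ℕ => x + n • e) ?_ h hS
    intro a b hab
    have h1 : x + a • e = x + b • e := hab
    have h2 := congrArg Prod.fst h1
    have h3 := congrArg Prod.snd h1
    rw [fst_add_nsmul, fst_add_nsmul, add_right_inj, mul_eq_mul_right_iff] at h2
    rw [snd_add_nsmul, snd_add_nsmul, add_right_inj, mul_eq_mul_right_iff] at h3
    by_contra hne
    refine he (Prod.ext (h2.resolve_left ?_) (h3.resolve_left ?_)) <;> exact_mod_cast hne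
  -- The first index off `S` is positive because `x ∈ S`; its predecessor is the witness.
  have hpos : Nat.find hex ≠ 0 := fun h0 => by
    have := Nat.find_spec hex
    simp [h0, hx] at this
  obtain ⟨n, hn⟩ := Nat.exists_eq_succ_of_ne_zero hpos
  refine ⟨n, fun j hj => ?_, by simpa only [hn] using Nat.find_spec hex⟩
  have := Nat.find_min hex (m := j) (by omega)
  simpa using this

/-- From a point inside `S`, every axis-parallel ray runs through points inside `S` until it
hits `S`. -/
lemma exists_ray_hit {S : Set (ℤ × ℤ)} {x : ℤ × ℤ} (hx : x ∈ inside S) {e : ℤ × ℤ}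
    (he : dist1 e 0 = 1) :
    ∃ n : ℕ, (∀ j ≤ n, x + j • e ∈ inside S) ∧ x + (n + 1) • e ∈ S := by
  obtain ⟨hxS, hfin⟩ := hx
  have he0 : e ≠ 0 := by
    rintro rfl
    simp [dist1] at he
  -- The component of `x` is used because it is finite, whereas `inside S` need not be for general
  -- `S`.
  obtain ⟨n, hn, hlast⟩ := exists_last (hfin.image Subtype.val) (x := x) (e := e)
    ⟨⟨x, hxS⟩, rfl, rfl⟩ he0
  refine ⟨n, fun j hj => ?_, ?_⟩
  · obtain ⟨y, hy, hyj⟩ := hn j hj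
    rw [← hyj]
    refine ⟨y.2, ?_⟩
    rw [SimpleGraph.ConnectedComponent.mem_supp_iff] at hy
    rwa [hy]
  -- A successor off `S` would be adjacent to the last point of the run, hence in the same
  -- component.
  · by_contra hnS
    obtain ⟨y, hy, hyj⟩ := hn n le_rfl
    refine hlast ⟨⟨_, hnS⟩, ?_, rfl⟩
    rw [SimpleGraph.ConnectedComponent.mem_supp_iff] at hy ⊢
    rw [← hy]
    refine SimpleGraph.ConnectedComponent.sound (SimpleGraph.Adj.reachable ?_)
    have hadj := adj_add_nsmul he x n
    rw [← hyj] at hadj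
    exact hadj

/-! ### Closed curves and their sides -/

namespace ClosedCurve

variable (C : ClosedCurve)

lemma s_mod (i : ℕ) : C.s (i % C.m) = C.s i :=
  Function.Periodic.map_mod_nat C.periodic i

lemma finite_pts : C.pts.Finite := by
  refine ((Set.finite_Iio C.m).image C.s).subset ?_
  rintro _ ⟨i, rfl⟩
  exact ⟨i % C.m, Nat.mod_lt _ C.m_pos, C.s_mod i⟩

variable {C}

lemma IsSegment.subset_pts {σ : Set (ℤ × ℤ)} (h : C.IsSegment σ) : σ ⊆ C.pts := by
  obtain ⟨-, a, b, rfl⟩ := h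
  exact Set.image_subset_range _ _

lemma IsSegment.exists_side {σ : Set (ℤ × ℤ)} (h : C.IsSegment σ) : ∃ τ, σ ⊆ τ ∧ C.IsSide τ := by
  have hfin : {τ | C.IsSegment τ}.Finite :=
    C.finite_pts.finite_subsets.subset fun τ hτ => hτ.subset_pts
  exact hfin.exists_le_maximal h

lemma m_ne_one (hC : C.pts.Nontrivial) : C.m ≠ 1 := by
  intro hm
  obtain ⟨_, ⟨i, rfl⟩, _, ⟨j, rfl⟩, hij⟩ := hC
  apply hij
  rw [← C.s_mod i, ← C.s_mod j, hm, Nat.mod_one, Nat.mod_one]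

/-- Equal consecutive points would force `m ∣ 1` by injectivity over a period, making the curve
constant. -/
lemma adj_step (hC : C.pts.Nontrivial) (i : ℕ) : c2.Adj (C.s i) (C.s (i + 1)) := by
  refine (C.step i).resolve_left fun h => ?_
  have hm := m_ne_one hC
  have hpos := C.m_pos
  rw [← C.s_mod i, ← C.s_mod (i + 1)] at h
  have h1 : i % C.m = (i + 1) % C.m := C.inj _ _ (Nat.mod_lt _ hpos) (Nat.mod_lt _ hpos) h
  have h2 : 0 ≡ 1 [MOD C.m] := Nat.ModEq.add_left_cancel' i h1
  exact hm (Nat.dvd_one.1 ((Nat.modEq_zero_iff_dvd).1 h2.symm))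

/-- Extended to a maximal segment, this puts every curve point on a side that has a direction. -/
lemma isSegment_pair (hC : C.pts.Nontrivial) (i : ℕ) :
    C.IsSegment {C.s i, C.s (i + 1)} := by
  refine ⟨⟨⟨_, Set.mem_insert _ _⟩, Set.toFinite _, isConn_pair (adj_step hC i), ?_⟩,
    i, i + 1, ?_⟩
  · rw [Set.image_pair]
    exact collinear_pair ℝ _ _
  · have : Set.Icc i (i + 1) = {i, i + 1} := by
      ext k
      simp only [Set.mem_Icc, Set.mem_insert_iff, Set.mem_singleton_iff]
      omega
    rw [this, Set.image_pair]

end ClosedCurve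

/-- Turns real collinearity into an integer identity, linear in `r` once `p` and `q` are fixed. -/
lemma cross_eq_zero_of_collinear {σ : Set (ℤ × ℤ)} (h : Collinear ℝ (toPlane '' σ))
    {p q r : ℤ × ℤ} (hp : p ∈ σ) (hq : q ∈ σ) (hr : r ∈ σ) :
    (q.1 - p.1) * (r.2 - p.2) = (q.2 - p.2) * (r.1 - p.1) := by
  rw [collinear_iff_of_mem (Set.mem_image_of_mem _ hp)] at h
  obtain ⟨v, hv⟩ := h
  obtain ⟨s, hs⟩ := hv _ (Set.mem_image_of_mem _ hq)
  obtain ⟨t, ht⟩ := hv _ (Set.mem_image_of_mem _ hr)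
  simp only [toPlane, vadd_eq_add, Prod.ext_iff, Prod.fst_add, Prod.snd_add, Prod.smul_fst,
    Prod.smul_snd, smul_eq_mul] at hs ht
  have : ((q.1 : ℝ) - p.1) * (r.2 - p.2) = (q.2 - p.2) * (r.1 - p.1) := by
    rw [hs.1, hs.2, ht.1, ht.2]
    ring
  exact_mod_cast this

/-- A collinear set with two `c₂`-adjacent points is axis-parallel or slanted. -/
lemma isAxisParallel_or_isSlanted {σ : Set (ℤ × ℤ)} (h : Collinear ℝ (toPlane '' σ))
    {p q : ℤ × ℤ} (hp : p ∈ σ) (hq : q ∈ σ) (hpq : c2.Adj p q) :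
    IsAxisParallel σ ∨ IsSlanted σ := by
  obtain ⟨hne, h1, h2⟩ := hpq
  have hnt : σ.Nontrivial := ⟨p, hp, q, hq, hne⟩
  have key : ∀ r ∈ σ, (q.1 - p.1) * (r.2 - p.2) = (q.2 - p.2) * (r.1 - p.1) :=
    fun r hr => cross_eq_zero_of_collinear h hp hq hr
  have hne' : ¬ (q.1 - p.1 = 0 ∧ q.2 - p.2 = 0) := fun h0 =>
    hne (Prod.ext (by linarith [h0.1]) (by linarith [h0.2]))
  have hu : q.1 - p.1 = -1 ∨ q.1 - p.1 = 0 ∨ q.1 - p.1 = 1 := by grind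
  have hv : q.2 - p.2 = -1 ∨ q.2 - p.2 = 0 ∨ q.2 - p.2 = 1 := by grind
  rcases hu with hu | hu | hu <;> rcases hv with hv | hv | hv <;> rw [hu, hv] at key hne'
  · exact Or.inr ⟨hnt, Or.inl fun a ha b hb => by linarith [key a ha, key b hb]⟩
  · exact Or.inl ⟨hnt, Or.inl fun a ha b hb => by linarith [key a ha, key b hb]⟩
  · exact Or.inr ⟨hnt, Or.inr fun a ha b hb => by linarith [key a ha, key b hb]⟩
  · exact Or.inl ⟨hnt, Or.inr fun a ha b hb => by linarith [key a ha, key b hb]⟩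
  · simp at hne'
  · exact Or.inl ⟨hnt, Or.inr fun a ha b hb => by linarith [key a ha, key b hb]⟩
  · exact Or.inr ⟨hnt, Or.inr fun a ha b hb => by linarith [key a ha, key b hb]⟩
  · exact Or.inl ⟨hnt, Or.inl fun a ha b hb => by linarith [key a ha, key b hb]⟩
  · exact Or.inr ⟨hnt, Or.inl fun a ha b hb => by linarith [key a ha, key b hb]⟩

/-- In a set contained in an axis-parallel line, a point whose successor in one of the two
directions of the line is missing is an endpoint. -/
lemma isEndpoint_of_succ_notMem {σ : Set (ℤ × ℤ)} {e : ℤ × ℤ} {p : ℤ × ℤ} (hp : p ∈ σ)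
    (he : (e = (1, 0) ∨ e = (-1, 0)) ∧ (∀ p ∈ σ, ∀ q ∈ σ, p.2 = q.2) ∨
      (e = (0, 1) ∨ e = (0, -1)) ∧ (∀ p ∈ σ, ∀ q ∈ σ, p.1 = q.1))
    (hlast : p + e ∉ σ) : IsEndpoint σ p := by
  -- On the line, the only possible neighbours of `p` are `p + e` and `p - e`.
  have key : ∀ q ∈ σ, c2.Adj p q → q = p - e := by
    rintro q hq ⟨hne, h1, h2⟩
    have hne1 : q ≠ p + e := fun h => hlast (h ▸ hq)
    rw [ne_eq, Prod.ext_iff] at hne hne1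
    rw [Prod.ext_iff]
    rcases he with ⟨rfl | rfl, hl⟩ | ⟨rfl | rfl, hl⟩ <;>
    · have := hl p hp q hq
      simp only [Prod.fst_add, Prod.snd_add, Prod.fst_sub, Prod.snd_sub] at hne1 ⊢
      grind
  exact ⟨hp, fun a ha b hb => (key a ha.1 ha.2).trans (key b hb.1 hb.2).symm⟩

/-- From a point of an axis-parallel side one reaches endpoints of the side in both directions. -/
lemma exists_run_of_isAxisParallel {σ : Set (ℤ × ℤ)} (hfin : σ.Finite) (hax : IsAxisParallel σ)
    {p : ℤ × ℤ} (hp : p ∈ σ) :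
    ∃ e : ℤ × ℤ, (e = (1, 0) ∨ e = (0, 1)) ∧ ∃ a b : ℕ,
      (∀ j ≤ a, p + j • (-e) ∈ σ) ∧ (∀ j ≤ b, p + j • e ∈ σ) ∧
      IsEndpoint σ (p + a • (-e)) ∧ IsEndpoint σ (p + b • e) := by
  obtain ⟨-, hl | hl⟩ := hax
  · obtain ⟨a, ha, ha'⟩ := exists_last hfin hp (e := -(1, 0)) (by simp)
    obtain ⟨b, hb, hb'⟩ := exists_last hfin hp (e := (1, 0)) (by simp)
    rw [add_smul, one_smul, ← add_assoc] at ha' hb'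
    exact ⟨(1, 0), Or.inl rfl, a, b, ha, hb,
      isEndpoint_of_succ_notMem (ha a le_rfl) (Or.inl ⟨Or.inr (by simp), hl⟩) ha',
      isEndpoint_of_succ_notMem (hb b le_rfl) (Or.inl ⟨Or.inl rfl, hl⟩) hb'⟩
  · obtain ⟨a, ha, ha'⟩ := exists_last hfin hp (e := -(0, 1)) (by simp)
    obtain ⟨b, hb, hb'⟩ := exists_last hfin hp (e := (0, 1)) (by simp)
    rw [add_smul, one_smul, ← add_assoc] at ha' hb'
    exact ⟨(0, 1), Or.inr rfl, a, b, ha, hb,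
      isEndpoint_of_succ_notMem (ha a le_rfl) (Or.inr ⟨Or.inr (by simp), hl⟩) ha',
      isEndpoint_of_succ_notMem (hb b le_rfl) (Or.inr ⟨Or.inl rfl, hl⟩) hb'⟩

/-- A bounding curve has at least two points. -/
lemma ClosedCurve.IsBoundingCurve.nontrivial {C : ClosedCurve} {D : Set (ℤ × ℤ)}
    (hC : C.IsBoundingCurve D) : C.pts.Nontrivial := by
  obtain ⟨⟨I, E, -, hI, -⟩, -⟩ := hC
  obtain ⟨⟨x, hx⟩, hxI⟩ := I.nonempty_supp
  have hin : x ∈ inside C.pts := by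
    refine ⟨hx, ?_⟩
    rw [SimpleGraph.ConnectedComponent.mem_supp_iff] at hxI
    rwa [hxI]
  -- The rays east and west from an inside point hit the curve on opposite sides of it.
  obtain ⟨a, -, ha⟩ := exists_ray_hit hin (e := (1, 0)) (by simp [dist1])
  obtain ⟨b, -, hb⟩ := exists_ray_hit hin (e := (-1, 0)) (by simp [dist1])
  refine ⟨_, ha, _, hb, fun h => ?_⟩
  have h1 := congrArg Prod.fst h
  rw [fst_add_nsmul, fst_add_nsmul] at h1
  push_cast at h1
  linarith

/-! ### Spreading the displacement bound over a disk -/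

section Displacement

variable {X D : Set (ℤ × ℤ)} {C : ClosedCurve} {f : X → X} {k : ℤ}

/-- A displacement bound at the endpoints of the axis-parallel sides and on the slanted sides of
a bounding curve holds on the whole curve. -/
lemma dist1_le_of_mem_pts (hf : IsContinuousSelfMap c1 X f) (hC : C.IsBoundingCurve D)
    (hX : C.pts ⊆ X)
    (hk : ∀ x : X, (x : ℤ × ℤ) ∈ C.axisParallelEndpoints ∪ C.slantedPoints → dist1 (f x) x ≤ k)
    (x : X) (hx : (x : ℤ × ℤ) ∈ C.pts) : dist1 (f x) x ≤ k := by
  obtain ⟨x, hxX⟩ := x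
  obtain ⟨i, rfl⟩ := hx
  obtain ⟨σ, hsub, hσ⟩ := (ClosedCurve.isSegment_pair hC.nontrivial i).exists_side
  have hσX : σ ⊆ X := hσ.prop.subset_pts.trans hX
  have hi : C.s i ∈ σ := hsub (by simp)
  rcases isAxisParallel_or_isSlanted hσ.prop.1.2.2.2 hi (hsub (by simp))
    (ClosedCurve.adj_step hC.nontrivial i) with hax | hsl
  · obtain ⟨e, he, a, b, ha, hb, hea, heb⟩ :=
      exists_run_of_isAxisParallel hσ.prop.1.2.1 hax hi
    exact dist1_le_of_run hf he hxX (fun j hj => hσX (ha j hj)) (fun j hj => hσX (hb j hj))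
      (hk _ (Or.inl ⟨σ, hσ, hax, hea⟩)) (hk _ (Or.inl ⟨σ, hσ, hax, heb⟩))
  · exact hk _ (Or.inr ⟨σ, hσ, hsl, hi⟩)

/-- A displacement bound on a bounding curve holds inside it. -/
lemma dist1_le_of_mem_inside (hf : IsContinuousSelfMap c1 X f)
    (hX : C.pts ∪ inside C.pts ⊆ X)
    (hk : ∀ x : X, (x : ℤ × ℤ) ∈ C.pts → dist1 (f x) x ≤ k)
    (x : X) (hx : (x : ℤ × ℤ) ∈ inside C.pts) : dist1 (f x) x ≤ k := by
  obtain ⟨a, ha, ha'⟩ := exists_ray_hit hx (e := -(1, 0)) (by simp [dist1])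
  obtain ⟨b, hb, hb'⟩ := exists_ray_hit hx (e := (1, 0)) (by simp [dist1])
  -- The run includes step `n + 1`, where the ray meets the curve and the bound is known.
  have key : ∀ (e : ℤ × ℤ) (n : ℕ), (∀ j ≤ n, x + j • e ∈ inside C.pts) →
      x + (n + 1) • e ∈ C.pts → ∀ j ≤ n + 1, x + j • e ∈ X := by
    intro e n hn hn' j hj
    rcases Nat.le_succ_iff.1 hj with h | rfl
    · exact hX (Or.inr (hn j h))
    · exact hX (Or.inl hn')
  exact dist1_le_of_run hf (Or.inl rfl) x.2 (key _ a ha ha') (key _ b hb hb')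
    (hk _ ha') (hk _ hb')

end Displacement

/-- A displacement bound on the points outside the given disks, the endpoints of the
axis-parallel sides and the slanted sides of bounding curves holds everywhere. -/
lemma dist1_le_of_bounding {ι : Type*} {X : Set (ℤ × ℤ)} {V : ι → Set (ℤ × ℤ)}
    {C : ι → ClosedCurve} (hVX : ∀ i, V i ⊆ X) (hC : ∀ i, (C i).IsBoundingCurve (V i))
    {f : X → X} (hf : IsContinuousSelfMap c1 X f) {k : ℤ}
    (hk : ∀ x : X, (x : ℤ × ℤ) ∈ (X \ ⋃ i, V i) ∪
      ⋃ i, ((C i).axisParallelEndpoints ∪ (C i).slantedPoints) → dist1 (f x) x ≤ k)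
    (x : X) : dist1 (f x) x ≤ k := by
  by_cases hx : (x : ℤ × ℤ) ∈ ⋃ i, V i
  · obtain ⟨i, hi⟩ := Set.mem_iUnion.1 hx
    have hVi := (hC i).2
    have hX : (C i).pts ∪ inside (C i).pts ⊆ X := hVi ▸ hVX i
    have hpts := dist1_le_of_mem_pts hf (hC i) (Set.subset_union_left.trans hX)
      fun y hy => hk y (Or.inr (Set.mem_iUnion.2 ⟨i, hy⟩))
    rw [hVi] at hi
    exact hi.elim (hpts x) (dist1_le_of_mem_inside hf hX hpts x)
  · exact hk x (Or.inl ⟨x.2, hx⟩)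

end Digital

theorem theorem6p4 (n : ℕ) (X : Set (ℤ × ℤ)) (V : Fin n → Set (ℤ × ℤ))
    (C : Fin n → Digital.ClosedCurve)
    (hV : ∀ i, Digital.IsThickConvexDisk (V i))
    (hVX : ∀ i, V i ⊆ X)
    (hC : ∀ i, (C i).IsBoundingCurve (V i))
    (A : Set (ℤ × ℤ))
    (hA : A = (X \ ⋃ i, V i) ∪ ⋃ i, ((C i).axisParallelEndpoints ∪ (C i).slantedPoints)) :
    Digital.IsFreezingSet Digital.c1 X A ∧
      ∀ f : X → X, Digital.IsContinuousSelfMap Digital.c1 X f →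
        (∀ x : X, (x : ℤ × ℤ) ∈ A → Digital.IsApproxFixedPt Digital.c1 f x) →
        ∀ x : X, Digital.IsApproxFixedPt Digital.c1 f x := by
  subst hA
  refine ⟨⟨?_, fun g hg hfix => ?_⟩, fun f hf happ x => ?_⟩
  · refine Set.union_subset Set.sdiff_subset (Set.iUnion_subset fun i => ?_)
    have hpts : (C i).pts ⊆ X := by
      refine Set.Subset.trans ?_ (hVX i)
      rw [(hC i).2]
      exact Set.subset_union_left
    rintro p (⟨σ, hσ, -, hp⟩ | ⟨σ, hσ, -, hp⟩)
    · exact hpts (hσ.prop.subset_pts hp.1)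
    · exact hpts (hσ.prop.subset_pts hp)
  · funext x
    exact Subtype.ext (Digital.dist1_le_zero_iff.1 (Digital.dist1_le_of_bounding hVX hC hg
      (fun y hy => Digital.dist1_le_zero_iff.2 (congrArg Subtype.val (hfix y hy))) x))
  · exact Digital.isApproxFixedPt_iff.2 (Digital.dist1_le_of_bounding hVX hC hf
      (fun y hy => Digital.isApproxFixedPt_iff.1 (happ y hy)) x)
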